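/- Let $f,G:\mathbb R\times\mathbb R^n\to\mathbb R^n$ be of class $C^2$, let $J_f,J_G$ be their Jacobian matrices with respect to the state $x$, and put $A=J_f^\top+J_f$, $R=J_G^\top+J_G$. For symmetric matrices, $P\le Q$ means $v^\top Pv\le v^\top Qv$ for all $v\in\mathbb R^n$; $|\cdot|$ is the Euclidean norm. Suppose that there are $m,M,k,L>0$, a function $\varepsilon:\mathbb R\to(0,\infty)$ and a strictly increasing sequence $(a_i)_{i\in\mathbb Z}$ of reals with $a_i\to\pm\infty$ as $i\to\pm\infty$ such that for every $i\in\mathbb Z$: - either $R(t,x)\ge mI_n$ for all $t\in[a_{2i},a_{2i+1}]$, $x\in\mathbb R^n$, or $R(t,x)\le -mI_n$ for all $t\in[a_{2i},a_{2i+1}]$, $x\in\mathbb R^n$; - $\varepsilon$ is bounded on $[a_{2i},a_{2i+1}]$, and $A(t,x)\le\varepsilon(t)I_n$ for all $t\in[a_{2i},a_{2i+1}]$, $x\in\mathbb R^n$; - $A(t,x)\le MI_n$ for all $t\in[a_{2i+1},a_{2i+2}]$, $x\in\mathbb R^n$; - $a_{2i+1}-a_{2i}\ge k$ and $a_{2i+2}-a_{2i+1}\le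 L$. Then for every $\alpha>0$ there is a function $u:\mathbb R\to\mathbb R$ of class $C^2$ such that the system $$\dot x=f(t,x)+u(t)G(t,x)\qquad(\ast)$$ is forward complete (for all $t_0\in\mathbb R$, $x_0\in\mathbb R^n$ there is a solution on $[t_0,\infty)$ with $x(t_0)=x_0$), contractive with rate $\alpha$, and incrementally exponentially stable with rate $\alpha$; that is: - (contractive) there is $K>0$ such that for all $t_0\in\mathbb R$, every solution $x$ of $(\ast)$ on $[t_0,\infty)$ and every solution $\delta x$ on $[t_0,\infty)$ of $\dot{\delta x}=\bigl(J_f(t,x(t))+u(t)J_G(t,x(t))\bigr)\delta x$, one has $|\delta x(t)|\le K|\delta x(t_0)|e^{-\alpha(t-t_0)}$ for all $t\ge t_0$; - (incrementally exponentially stable) there is $K>0$ such that for all $t_0\in\mathbb R$ and all solutions $x_1,x_2$ of $(\ast)$ on $[t_0,\infty)$, one has $|x_1(t)-x_2(t)|\le K|x_1(t_0)-x_2(t_0)|e^{-\alpha(t-t_0)}$ for all $t\ge t_0$. -/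

import Mathlib

open Set Filter Matrix
open scoped Topology

/-- A time-varying vector field `(t, x) ↦ F t x` on Euclidean space `ℝⁿ`. -/
abbrev TimeVectorField (n : ℕ) : Type :=
  ℝ → EuclideanSpace ℝ (Fin n) → EuclideanSpace ℝ (Fin n)

/-- `F` is of class `C²` jointly in `(t, x)`. -/
def IsC2Field {n : ℕ} (F : TimeVectorField n) : Prop :=
  ContDiff ℝ 2 (fun p : ℝ × EuclideanSpace ℝ (Fin n) => F p.1 p.2)

/-- The vector field `f(t, x) + u(t) G(t, x)` obtained from the input `u`. -/
def closedLoop {n : ℕ} (f G : TimeVectorField n) (u : ℝ → ℝ) : TimeVectorField n :=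
  fun t x => f t x + u t • G t x

/-- `x` solves `ẋ = F(t, x)` on `[t₀, ∞)` (with the one-sided derivative at `t₀`). -/
def SolvesFrom {n : ℕ} (F : TimeVectorField n) (t₀ : ℝ)
    (x : ℝ → EuclideanSpace ℝ (Fin n)) : Prop :=
  ∀ t ∈ Ici t₀, HasDerivWithinAt x (F t (x t)) (Ici t₀) t

/-- `δ` solves on `[t₀, ∞)` the linearized dynamics `δ̇ = (∂F/∂x)(t, x(t)) δ` along `x`. -/
def SolvesLinearizedFrom {n : ℕ} (F : TimeVectorField n) (t₀ : ℝ)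
    (x δ : ℝ → EuclideanSpace ℝ (Fin n)) : Prop :=
  ∀ t ∈ Ici t₀, HasDerivWithinAt δ (fderiv ℝ (F t) (x t) (δ t)) (Ici t₀) t

/-- Every initial condition starts a solution that is defined for all later times. -/
def ForwardComplete {n : ℕ} (F : TimeVectorField n) : Prop :=
  ∀ (t₀ : ℝ) (x₀ : EuclideanSpace ℝ (Fin n)),
    ∃ x : ℝ → EuclideanSpace ℝ (Fin n), x t₀ = x₀ ∧ SolvesFrom F t₀ x

/-- `ẋ = F(t, x)` is contractive with exponential rate `α`: the constant `k` is common to all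
initial times, all solutions and all solutions of the linearized dynamics. -/
def ContractiveWithRate {n : ℕ} (F : TimeVectorField n) (α : ℝ) : Prop :=
  ∃ k : ℝ, 0 < k ∧ ∀ (t₀ : ℝ) (x δ : ℝ → EuclideanSpace ℝ (Fin n)),
    SolvesFrom F t₀ x → SolvesLinearizedFrom F t₀ x δ →
      ∀ t, t₀ ≤ t → ‖δ t‖ ≤ k * ‖δ t₀‖ * Real.exp (-α * (t - t₀))

/-- `ẋ = F(t, x)` is incrementally exponentially stable with rate `α`: the constant `k` is common
to all initial times and all pairs of solutions. -/
def IESWithRate {n : ℕ} (F : TimeVectorField n) (α : ℝ) : Prop :=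
  ∃ k : ℝ, 0 < k ∧ ∀ (t₀ : ℝ) (x₁ x₂ : ℝ → EuclideanSpace ℝ (Fin n)),
    SolvesFrom F t₀ x₁ → SolvesFrom F t₀ x₂ →
      ∀ t, t₀ ≤ t → ‖x₁ t - x₂ t‖ ≤ k * ‖x₁ t₀ - x₂ t₀‖ * Real.exp (-α * (t - t₀))

/-- The Jacobian matrix of `F` in the state variable. -/
noncomputable def jacobian {n : ℕ} (F : TimeVectorField n) (t : ℝ)
    (x : EuclideanSpace ℝ (Fin n)) : Matrix (Fin n) (Fin n) ℝ :=
  Matrix.of fun i j => fderiv ℝ (F t) x (EuclideanSpace.single j 1) i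

/-- The symmetric part `Jᵀ + J` of the Jacobian (without the factor `1/2`). -/
noncomputable def symJacobian {n : ℕ} (F : TimeVectorField n) (t : ℝ)
    (x : EuclideanSpace ℝ (Fin n)) : Matrix (Fin n) (Fin n) ℝ :=
  (jacobian F t x)ᵀ + jacobian F t x

/-- The order on symmetric matrices: `xᵀ P x ≤ xᵀ Q x` for all `x`. -/
def QuadLE {n : ℕ} (P Q : Matrix (Fin n) (Fin n) ℝ) : Prop :=
  ∀ x : Fin n → ℝ, x ⬝ᵥ (P *ᵥ x) ≤ x ⬝ᵥ (Q *ᵥ x)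

/-- With `A`, `R` the symmetric parts of the Jacobians of `f`, `G`: there is a partition of the
time axis into alternating intervals `[a₂ᵢ, a₂ᵢ₊₁]` of length at least `k`, on each of which `R` is
uniformly definite (of either sign) and `A ≤ ε(t) I`, and gaps `[a₂ᵢ₊₁, a₂ᵢ₊₂]` of length at most
`L`, on which `A ≤ M I`. The positive function `ε` is bounded on each interval
`[a₂ᵢ, a₂ᵢ₊₁]`, not necessarily uniformly in `i`. -/
def AlternatingDefiniteness {n : ℕ} (f G : TimeVectorField n) : Prop :=
  ∃ m : ℝ, 0 < m ∧ ∃ a : ℤ → ℝ,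
    StrictMono a ∧ Tendsto a atTop atTop ∧ Tendsto a atBot atBot ∧
    (∀ i : ℤ,
      (∀ t ∈ Icc (a (2 * i)) (a (2 * i + 1)), ∀ x : EuclideanSpace ℝ (Fin n),
        QuadLE (m • (1 : Matrix (Fin n) (Fin n) ℝ)) (symJacobian G t x)) ∨
      (∀ t ∈ Icc (a (2 * i)) (a (2 * i + 1)), ∀ x : EuclideanSpace ℝ (Fin n),
        QuadLE (symJacobian G t x) (-m • (1 : Matrix (Fin n) (Fin n) ℝ)))) ∧
    (∃ (M : ℝ) (ε : ℝ → ℝ), 0 < M ∧ (∀ t, 0 < ε t) ∧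
      (∀ i : ℤ, BddAbove (ε '' Icc (a (2 * i)) (a (2 * i + 1)))) ∧
      (∀ i : ℤ, ∀ t ∈ Icc (a (2 * i + 1)) (a (2 * i + 2)), ∀ x : EuclideanSpace ℝ (Fin n),
        QuadLE (symJacobian f t x) (M • (1 : Matrix (Fin n) (Fin n) ℝ))) ∧
      (∀ i : ℤ, ∀ t ∈ Icc (a (2 * i)) (a (2 * i + 1)), ∀ x : EuclideanSpace ℝ (Fin n),
        QuadLE (symJacobian f t x) (ε t • (1 : Matrix (Fin n) (Fin n) ℝ)))) ∧
    (∃ k L : ℝ, 0 < k ∧ 0 < L ∧ ∀ i : ℤ,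
      k ≤ a (2 * i + 1) - a (2 * i) ∧ a (2 * i + 2) - a (2 * i + 1) ≤ L)

/-!
The matrix inequalities say how the quadratic forms of the Jacobians act on the squared distance
`r` of two solutions, or on the squared length of a solution of the linearized dynamics: if the
symmetric part `DF(t, ·)ᵀ + DF(t, ·)` of the closed loop is at most `Λ t` everywhere, then
`r' ≤ Λ r` (`LogNormLE.two_inner_sub_le`). So everything rests on choosing `u` such that this scalar
inequality forces `r` to decay like `exp (-2 α t)`, with one constant for all initial times.

Write `[b i, c i]` for the interval on which `R` is definite. The input is `0` in the gaps, where
`Λ = M` can be taken. On `[b i, c i]` it is a plateau function whose sign is opposite to that of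
`R`, so that `Λ` drops from `E i`, a bound of `ε` there, to `-2 α - β` on the plateau. The numbers
`E i` need not be bounded in `i`, so the two ramps are made so short that `r * exp (2 α t)` gains at
most a factor `e` on each. The gain over a gap is at most `exp ((M + 2 α) L)`, and as a plateau has
length at least `k / 2`, one value of `β` makes `r * exp (2 α t)` nonincreasing over each complete
cell `[b i, b (i + 1)]`. Only the first and the last cell of a time interval can be incomplete,
which costs a bounded factor (`le_mul_of_alternating_rates`, `exists_feedback`).

Forward completeness follows from the same bound, which is locally bounded in time. It gives an
a priori estimate on each compact time interval; the field may therefore be cut off outside a large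
ball, and a single application of the Picard–Lindelöf theorem to the resulting bounded field gives
the solution on the whole interval (`exists_solution_Icc`, `exists_solution_Ici`).
-/

/-! ### Differential inequalities -/

theorem le_mul_exp_of_hasDerivAt_le {r r' : ℝ → ℝ} {s t c : ℝ} (hst : s ≤ t)
    (hcont : ContinuousOn r (Icc s t)) (hder : ∀ τ ∈ Ioo s t, HasDerivAt r (r' τ) τ)
    (hle : ∀ τ ∈ Ioo s t, r' τ ≤ c * r τ) :
    r t ≤ r s * Real.exp (c * (t - s)) := by
  have hanti : AntitoneOn (fun τ => r τ * Real.exp (-(c * (τ - s)))) (Icc s t) := by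
    refine antitoneOn_of_hasDerivWithinAt_nonpos
      (f' := fun τ => (r' τ - c * r τ) * Real.exp (-(c * (τ - s)))) (convex_Icc s t)
      (hcont.mul (by fun_prop)) ?_ ?_
    · intro τ hτ
      rw [interior_Icc] at hτ
      have h1 : HasDerivAt (fun τ => Real.exp (-(c * (τ - s))))
          (Real.exp (-(c * (τ - s))) * (-(c * 1))) τ :=
        ((((hasDerivAt_id τ).sub_const s).const_mul c).fun_neg).exp
      exact (((hder τ hτ).mul h1).congr_deriv (by ring)).hasDerivWithinAt
    · intro τ hτ
      rw [interior_Icc] at hτ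
      exact mul_nonpos_of_nonpos_of_nonneg (sub_nonpos.2 (hle τ hτ)) (Real.exp_pos _).le
  have h := hanti (left_mem_Icc.2 hst) (right_mem_Icc.2 hst) hst
  simp only [sub_self, mul_zero, neg_zero, Real.exp_zero, mul_one] at h
  calc r t = r t * Real.exp (-(c * (t - s))) * Real.exp (c * (t - s)) := by
        rw [mul_assoc, ← Real.exp_add]; simp
    _ ≤ r s * Real.exp (c * (t - s)) := by gcongr

/-! ### Vector fields with a logarithmic norm bound -/

section LogNorm

variable {E : Type*} [NormedAddCommGroup E] [InnerProductSpace ℝ E]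

/-- The symmetric part `DF(x)ᵀ + DF(x)` of the derivative of `F` is at most `c` at every point;
in other words, the Euclidean logarithmic norm of `DF` is at most `c / 2` everywhere. -/
def LogNormLE (F : E → E) (c : ℝ) : Prop :=
  ∀ x v : E, 2 * inner ℝ v (fderiv ℝ F x v) ≤ c * ‖v‖ ^ 2

theorem LogNormLE.mono {F : E → E} {c d : ℝ} (h : LogNormLE F c) (hcd : c ≤ d) :
    LogNormLE F d := fun x v => (h x v).trans (by gcongr)

/-- The mean value theorem turns a bound on the logarithmic norm into a one-sided Lipschitz
condition. -/
theorem LogNormLE.two_inner_sub_le {F : E → E} {c : ℝ} (h : LogNormLE F c)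
    (hF : Differentiable ℝ F) (x y : E) :
    2 * inner ℝ (x - y) (F x - F y) ≤ c * ‖x - y‖ ^ 2 := by
  have hd : ∀ s : ℝ, HasDerivAt (fun s : ℝ => 2 * inner ℝ (x - y) (F (y + s • (x - y))))
      (2 * inner ℝ (x - y) (fderiv ℝ F (y + s • (x - y)) (x - y))) s := by
    intro s
    have h1 : HasDerivAt (fun s : ℝ => y + s • (x - y)) (x - y) s := by
      simpa using ((hasDerivAt_id s).smul_const (x - y)).const_add y
    have h2 := (hF (y + s • (x - y))).hasFDerivAt.comp_hasDerivAt s h1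
    simpa using ((hasDerivAt_const s (x - y)).inner ℝ h2).const_mul 2
  have := image_sub_le_mul_sub_of_deriv_le (fun s => (hd s).differentiableAt)
    (C := c * ‖x - y‖ ^ 2) (fun s => by rw [(hd s).deriv]; exact h _ _) zero_le_one
  simp only [one_smul, add_sub_cancel, zero_smul, add_zero, sub_zero, mul_one] at this
  rwa [inner_sub_right, mul_sub]

/-- Two solutions of `ẋ = F(t, x)` separate at most exponentially. -/
theorem norm_sub_sq_le_of_logNormLE {F : ℝ → E → E} {s t c : ℝ} (hst : s ≤ t)
    (hF : ∀ τ ∈ Icc s t, Differentiable ℝ (F τ)) (hc : ∀ τ ∈ Icc s t, LogNormLE (F τ) c)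
    {x y : ℝ → E} (hx : ∀ τ ∈ Icc s t, HasDerivWithinAt x (F τ (x τ)) (Icc s t) τ)
    (hy : ∀ τ ∈ Icc s t, HasDerivWithinAt y (F τ (y τ)) (Icc s t) τ) :
    ‖x t - y t‖ ^ 2 ≤ ‖x s - y s‖ ^ 2 * Real.exp (c * (t - s)) := by
  have hd : ∀ τ ∈ Icc s t, HasDerivWithinAt (fun τ => ‖x τ - y τ‖ ^ 2)
      (2 * inner ℝ (x τ - y τ) (F τ (x τ) - F τ (y τ))) (Icc s t) τ :=
    fun τ hτ => ((hx τ hτ).sub (hy τ hτ)).norm_sq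
  exact le_mul_exp_of_hasDerivAt_le hst (fun τ hτ => (hd τ hτ).continuousWithinAt)
    (fun τ hτ => (hd τ (Ioo_subset_Icc_self hτ)).hasDerivAt (Icc_mem_nhds hτ.1 hτ.2))
    (fun τ hτ => (hc τ (Ioo_subset_Icc_self hτ)).two_inner_sub_le
      (hF τ (Ioo_subset_Icc_self hτ)) _ _)

/-! ### Global existence -/

/-- The Picard–Lindelöf theorem on a whole compact interval, for a bounded `C¹` field. -/
theorem exists_solution_Icc_of_bounded [FiniteDimensional ℝ E] {F : ℝ → E → E}
    (hF : ContDiff ℝ 1 (fun p : ℝ × E => F p.1 p.2)) {t₀ T : ℝ} (hT : t₀ ≤ T) {K : ℝ}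
    (hK : ∀ t ∈ Icc t₀ T, ∀ x, ‖F t x‖ ≤ K) (x₀ : E) :
    ∃ x : ℝ → E, x t₀ = x₀ ∧ ∀ t ∈ Icc t₀ T, HasDerivWithinAt x (F t (x t)) (Icc t₀ T) t := by
  have hK0 : 0 ≤ K := (norm_nonneg _).trans (hK t₀ (left_mem_Icc.2 hT) 0)
  lift K to NNReal using hK0
  let a : NNReal := K * (T - t₀).toNNReal
  obtain ⟨C, hC⟩ := hF.contDiffOn.exists_lipschitzOnWith one_ne_zero
    ((convex_Icc t₀ T).prod (convex_closedBall x₀ a))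
    (isCompact_Icc.prod (isCompact_closedBall x₀ a))
  have hPL : IsPicardLindelof F (⟨t₀, left_mem_Icc.2 hT⟩ : Icc t₀ T) x₀ a 0 K C := by
    refine ⟨fun t ht x hx y hy => ?_, fun x _ => ?_, fun t ht x _ => hK t ht x, ?_⟩
    · simpa [Prod.edist_eq] using hC (mk_mem_prod ht hx) (mk_mem_prod ht hy)
    · exact (hF.continuous.comp (by fun_prop : Continuous fun t : ℝ => (t, x))).continuousOn
    · have : 0 ≤ T - t₀ := sub_nonneg.2 hT
      simp [a, this]
  exact hPL.exists_eq_forall_mem_Icc_hasDerivWithinAt₀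

/-- A field with a logarithmic norm bound has solutions on the whole interval: the bound makes
`‖x‖ ^ 2 + 1` grow at most exponentially, also after the field has been cut off outside a ball that
this a priori estimate confines the solution to. -/
theorem exists_solution_Icc [FiniteDimensional ℝ E] {F : ℝ → E → E}
    (hF : ContDiff ℝ 1 (fun p : ℝ × E => F p.1 p.2)) {t₀ T c : ℝ} (hT : t₀ ≤ T)
    (hc : ∀ t ∈ Icc t₀ T, LogNormLE (F t) c) (x₀ : E) :
    ∃ x : ℝ → E, x t₀ = x₀ ∧ ∀ t ∈ Icc t₀ T, HasDerivWithinAt x (F t (x t)) (Icc t₀ T) t := by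
  have hFt : ∀ t, Differentiable ℝ (F t) := fun t =>
    (hF.comp (by fun_prop : ContDiff ℝ 1 fun x : E => (t, x))).differentiable one_ne_zero
  obtain ⟨d, hd⟩ := (isCompact_Icc (a := t₀) (b := T)).exists_bound_of_continuousOn
    (f := fun t => F t 0)
    (hF.continuous.comp (by fun_prop : Continuous fun t : ℝ => (t, (0 : E)))).continuousOn
  have hd0 : 0 ≤ d := (norm_nonneg _).trans (hd t₀ (left_mem_Icc.2 hT))
  have hgrow : ∀ t ∈ Icc t₀ T, ∀ x : E, 2 * inner ℝ x (F t x) ≤ (|c| + d) * (‖x‖ ^ 2 + 1) := by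
    intro t ht x
    have h1 := (hc t ht).two_inner_sub_le (hFt t) x 0
    have h2 : inner ℝ x (F t 0) ≤ ‖x‖ * d :=
      (real_inner_le_norm _ _).trans (by gcongr; exact hd t ht)
    rw [sub_zero, inner_sub_right] at h1
    nlinarith [le_abs_self c, abs_nonneg c, sq_nonneg (‖x‖ - 1), sq_nonneg ‖x‖,
      mul_nonneg hd0 (sq_nonneg (‖x‖ - 1)), mul_le_mul_of_nonneg_right (le_abs_self c)
      (sq_nonneg ‖x‖)]
  set B : ℝ := (‖x₀‖ ^ 2 + 1) * Real.exp ((|c| + d) * (T - t₀)) with hB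
  have hB1 : 1 ≤ B := by
    have : 0 ≤ (|c| + d) * (T - t₀) := mul_nonneg (by positivity) (sub_nonneg.2 hT)
    have := Real.one_le_exp this
    nlinarith [sq_nonneg ‖x₀‖]
  let χ : ContDiffBump (0 : E) := ⟨B, B + 1, by linarith, by linarith⟩
  obtain ⟨K, hK⟩ := ((isCompact_Icc (a := t₀) (b := T)).prod
    (isCompact_closedBall (0 : E) (B + 1))).exists_bound_of_continuousOn hF.continuous.continuousOn
  have hK0 : 0 ≤ K := (norm_nonneg _).trans
    (hK (t₀, 0) ⟨left_mem_Icc.2 hT, Metric.mem_closedBall_self (by linarith)⟩)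
  obtain ⟨x, hx0, hx⟩ := exists_solution_Icc_of_bounded (F := fun t x => χ x • F t x)
    ((χ.contDiff.comp contDiff_snd).smul hF) hT (K := K) (fun t ht x => by
      by_cases hxB : x ∈ Metric.closedBall (0 : E) (B + 1)
      · rw [norm_smul, Real.norm_of_nonneg χ.nonneg]
        exact (mul_le_of_le_one_left (norm_nonneg _) χ.le_one).trans (hK (t, x) ⟨ht, hxB⟩)
      · rw [χ.zero_of_le_dist (not_le.1 hxB).le, zero_smul, norm_zero]; exact hK0) x₀
  refine ⟨x, hx0, fun t ht => ?_⟩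
  have hnd : ∀ τ ∈ Icc t₀ T, HasDerivWithinAt (fun τ => ‖x τ‖ ^ 2 + 1)
      (2 * inner ℝ (x τ) (χ (x τ) • F τ (x τ))) (Icc t₀ T) τ :=
    fun τ hτ => (hx τ hτ).norm_sq.add_const 1
  have hbd : ‖x t‖ ^ 2 + 1 ≤ (‖x t₀‖ ^ 2 + 1) * Real.exp ((|c| + d) * (t - t₀)) := by
    refine le_mul_exp_of_hasDerivAt_le (r := fun τ => ‖x τ‖ ^ 2 + 1) ht.1
      (fun τ hτ => ((hnd τ ⟨hτ.1, hτ.2.trans ht.2⟩).continuousWithinAt).mono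
        (Icc_subset_Icc_right ht.2))
      (fun τ hτ => (hnd τ ⟨hτ.1.le, hτ.2.le.trans ht.2⟩).hasDerivAt
        (Icc_mem_nhds hτ.1 (hτ.2.trans_le ht.2))) (fun τ hτ => ?_)
    rw [inner_smul_right]
    have h1 := hgrow τ ⟨hτ.1.le, hτ.2.le.trans ht.2⟩ (x τ)
    have h2 : 0 ≤ (|c| + d) * (‖x τ‖ ^ 2 + 1) := by positivity
    have h3 : χ (x τ) ≤ 1 := χ.le_one
    have h4 : 0 ≤ χ (x τ) := χ.nonneg
    calc 2 * (χ (x τ) * inner ℝ (x τ) (F τ (x τ)))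
        = χ (x τ) * (2 * inner ℝ (x τ) (F τ (x τ))) := by ring
      _ ≤ χ (x τ) * ((|c| + d) * (‖x τ‖ ^ 2 + 1)) := by gcongr
      _ ≤ _ := mul_le_of_le_one_left h2 h3
  have hxB : ‖x t‖ ≤ B := by
    have : (‖x t₀‖ ^ 2 + 1) * Real.exp ((|c| + d) * (t - t₀)) ≤ B := by
      rw [hx0, hB]; gcongr; exact ht.2
    nlinarith [norm_nonneg (x t)]
  have h := hx t ht
  rwa [χ.one_of_mem_closedBall (mem_closedBall_zero_iff.2 hxB), one_smul] at h

/-- A `C¹` field whose logarithmic norm is locally bounded in time is forward complete: the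
solutions on `[t₀, t₀ + N]` agree with each other and are glued together. -/
theorem exists_solution_Ici [FiniteDimensional ℝ E] {F : ℝ → E → E}
    (hF : ContDiff ℝ 1 (fun p : ℝ × E => F p.1 p.2))
    (hc : ∀ s t : ℝ, ∃ c, ∀ τ ∈ Icc s t, LogNormLE (F τ) c) (t₀ : ℝ) (x₀ : E) :
    ∃ x : ℝ → E, x t₀ = x₀ ∧ ∀ t ∈ Ici t₀, HasDerivWithinAt x (F t (x t)) (Ici t₀) t := by
  have hFt : ∀ t, Differentiable ℝ (F t) := fun t =>
    (hF.comp (by fun_prop : ContDiff ℝ 1 fun x : E => (t, x))).differentiable one_ne_zero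
  have hex : ∀ N : ℕ, ∃ x : ℝ → E, x t₀ = x₀ ∧
      ∀ t ∈ Icc t₀ (t₀ + N), HasDerivWithinAt x (F t (x t)) (Icc t₀ (t₀ + N)) t := fun N =>
    let ⟨_, hcN⟩ := hc t₀ (t₀ + N)
    exists_solution_Icc hF (by simp) hcN x₀
  choose X hX0 hX using hex
  have hagree : ∀ (N M : ℕ) (t : ℝ), t₀ ≤ t → t ≤ t₀ + N → t ≤ t₀ + M → X N t = X M t := by
    intro N M t h0 hN hM
    obtain ⟨c, hct⟩ := hc t₀ t
    have h := norm_sub_sq_le_of_logNormLE h0 (fun τ _ => hFt τ) hct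
      (fun τ hτ => (hX N τ ⟨hτ.1, hτ.2.trans hN⟩).mono (Icc_subset_Icc_right hN))
      (fun τ hτ => (hX M τ ⟨hτ.1, hτ.2.trans hM⟩).mono (Icc_subset_Icc_right hM))
    rw [hX0, hX0, sub_self, norm_zero, zero_pow two_ne_zero, zero_mul] at h
    exact sub_eq_zero.1 (norm_eq_zero.1 (pow_eq_zero_iff two_ne_zero |>.1
      (le_antisymm h (sq_nonneg _))))
  have hceil : ∀ t, t ≤ t₀ + (⌈t - t₀⌉₊ : ℝ) := fun t => by linarith [Nat.le_ceil (t - t₀)]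
  refine ⟨fun t => X ⌈t - t₀⌉₊ t, hX0 _, fun t ht => ?_⟩
  obtain ⟨N, hN⟩ := exists_nat_gt (t - t₀)
  have htN : t < t₀ + N := by linarith
  have heq : ∀ τ ∈ Icc t₀ (t₀ + N), X ⌈τ - t₀⌉₊ τ = X N τ := fun τ hτ =>
    hagree _ _ τ hτ.1 (hceil τ) hτ.2
  have h := (hX N t ⟨ht, htN.le⟩).congr heq (heq t ⟨ht, htN.le⟩)
  rw [← heq t ⟨ht, htN.le⟩] at h
  exact h.mono_of_mem_nhdsWithin
    (by rw [← Ici_inter_Iic]; exact inter_mem self_mem_nhdsWithin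
          (mem_nhdsWithin_of_mem_nhds (Iic_mem_nhds htN)))

end LogNorm

/-! ### Partitions of the time axis -/

theorem exists_mem_Ico_of_tendsto {b : ℤ → ℝ} (hb : StrictMono b)
    (htop : Tendsto b atTop atTop) (hbot : Tendsto b atBot atBot) (t : ℝ) :
    ∃ i, b i ≤ t ∧ t < b (i + 1) := by
  obtain ⟨j, hj⟩ := (htop.eventually_gt_atTop t).exists
  obtain ⟨k, hk⟩ := (hbot.eventually_le_atBot t).exists
  obtain ⟨i, hi, hmax⟩ := Int.exists_greatest_of_bdd (P := fun i => b i ≤ t)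
    ⟨j, fun z hz => (hb.lt_iff_lt.1 (hz.trans_lt hj)).le⟩ ⟨k, hk⟩
  exact ⟨i, hi, not_le.1 fun h => absurd (hmax _ h) (by lia)⟩

theorem eq_of_mem_Ico {b : ℤ → ℝ} (hb : StrictMono b) {i j : ℤ} {t : ℝ}
    (hi : b i ≤ t ∧ t < b (i + 1)) (hj : b j ≤ t ∧ t < b (j + 1)) : i = j := by
  have h1 := hb.lt_iff_lt.1 (hi.1.trans_lt hj.2)
  have h2 := hb.lt_iff_lt.1 (hj.1.trans_lt hi.2)
  lia

/-- Functions supported in disjoint intervals `(b i, c i)` that march off to infinity add up to a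
function as smooth as they are. -/
theorem exists_contDiff_glue {b c : ℤ → ℝ} (hbc : ∀ i, b i < c i) (hcb : ∀ i, c i < b (i + 1))
    (htop : Tendsto b atTop atTop) (hbot : Tendsto b atBot atBot) {k : WithTop ℕ∞}
    {g : ℤ → ℝ → ℝ} (hg : ∀ i, ContDiff ℝ k (g i)) (hl : ∀ i t, t ≤ b i → g i t = 0)
    (hr : ∀ i t, c i ≤ t → g i t = 0) :
    ∃ u : ℝ → ℝ, ContDiff ℝ k u ∧ ∀ i, ∀ t ∈ Ico (b i) (b (i + 1)), u t = g i t := by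
  have hb : StrictMono b := strictMono_int_of_lt_succ fun i => (hbc i).trans (hcb i)
  choose idx hidx using exists_mem_Ico_of_tendsto hb htop hbot
  have hcell : ∀ i, ∀ t ∈ Ico (b i) (b (i + 1)), g (idx t) t = g i t := fun i t ht => by
    rw [eq_of_mem_Ico hb (hidx t) ht]
  refine ⟨fun t => g (idx t) t, contDiff_iff_contDiffAt.2 fun t => ?_, hcell⟩
  -- The intervals `(c (i - 1), b (i + 1))` are open and cover the line; only `g i` lives there.
  have hwide : ∀ i, ∀ t ∈ Ioo (c (i - 1)) (b (i + 1)), g (idx t) t = g i t := by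
    intro i t ht
    rcases le_or_gt (b i) t with h | h
    · exact hcell i t ⟨h, ht.2⟩
    · rw [hcell (i - 1) t ⟨(hbc _).le.trans ht.1.le, by simpa using h⟩, hl i t h.le,
        hr _ t ht.1.le]
  have hnear : c (idx t - 1) < t := by
    have := hcb (idx t - 1)
    rw [sub_add_cancel] at this
    exact this.trans_le (hidx t).1
  exact (hg (idx t)).contDiffAt.congr_of_eventuallyEq
    (eventually_of_mem (Ioo_mem_nhds hnear (hidx t).2) (hwide (idx t)))

/-! ### Decay along alternating intervals -/

theorem growth_concat {ρ : ℝ → ℝ} {t₀ p m q D₁ D₂ : ℝ} (hρ : ∀ t, t₀ ≤ t → 0 ≤ ρ t)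
    (hD₁ : 1 ≤ D₁) (hD₂ : 1 ≤ D₂)
    (h₁ : ∀ s t, t₀ ≤ s → p ≤ s → s ≤ t → t ≤ m → ρ t ≤ D₁ * ρ s)
    (h₂ : ∀ s t, t₀ ≤ s → m ≤ s → s ≤ t → t ≤ q → ρ t ≤ D₂ * ρ s) :
    ∀ s t, t₀ ≤ s → p ≤ s → s ≤ t → t ≤ q → ρ t ≤ D₁ * D₂ * ρ s := by
  intro s t h0 hp hst hq
  have hs := hρ s h0
  rcases le_total t m with htm | htm
  · calc ρ t ≤ D₁ * ρ s := h₁ s t h0 hp hst htm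
      _ ≤ D₁ * D₂ * ρ s := by gcongr; exact le_mul_of_one_le_right (by linarith) hD₂
  rcases le_total m s with hms | hms
  · calc ρ t ≤ D₂ * ρ s := h₂ s t h0 hms hst hq
      _ ≤ D₁ * D₂ * ρ s := by gcongr; exact le_mul_of_one_le_left (by linarith) hD₁
  · calc ρ t ≤ D₂ * ρ m := h₂ m t (h0.trans hms) le_rfl htm hq
      _ ≤ D₂ * (D₁ * ρ s) := by gcongr; exact h₁ s m h0 hp hms le_rfl
      _ = D₁ * D₂ * ρ s := by ring

/-- If a quantity grows by at most a factor `D` inside each cell of a partition, and does not grow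
over a complete cell, then it never exceeds `D ^ 2` times its initial value: only the first and
the last cell can be incomplete. -/
theorem le_sq_mul_of_cells {b : ℤ → ℝ} (hb : StrictMono b) (htop : Tendsto b atTop atTop)
    (hbot : Tendsto b atBot atBot) {ρ : ℝ → ℝ} {t₀ D : ℝ} (hρ : ∀ t, t₀ ≤ t → 0 ≤ ρ t)
    (hD : 1 ≤ D)
    (hcell : ∀ i s t, t₀ ≤ s → b i ≤ s → s ≤ t → t ≤ b (i + 1) → ρ t ≤ D * ρ s)
    (hfull : ∀ i, t₀ ≤ b i → ρ (b (i + 1)) ≤ ρ (b i)) {t : ℝ} (ht : t₀ ≤ t) :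
    ρ t ≤ D ^ 2 * ρ t₀ := by
  obtain ⟨i, hi⟩ := exists_mem_Ico_of_tendsto hb htop hbot t₀
  obtain ⟨j, hj⟩ := exists_mem_Ico_of_tendsto hb htop hbot t
  have h0 := hρ t₀ le_rfl
  have hij : i < j + 1 := hb.lt_iff_lt.1 (hi.1.trans_lt (ht.trans_lt hj.2))
  rcases (Int.lt_add_one_iff.1 hij).eq_or_lt with rfl | hlt
  · calc ρ t ≤ D * ρ t₀ := hcell i t₀ t le_rfl hi.1 ht hj.2.le
      _ ≤ D ^ 2 * ρ t₀ := by gcongr; exact le_self_pow₀ hD two_ne_zero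
  · have hchain : ∀ j, i + 1 ≤ j → ρ (b j) ≤ ρ (b (i + 1)) := by
      intro j hij
      induction j, hij using Int.leInduction with
      | base => exact le_rfl
      | succ j hij ih => exact (hfull j (hi.2.le.trans (hb.monotone hij))).trans ih
    calc ρ t ≤ D * ρ (b j) :=
          hcell j _ t (hi.2.le.trans (hb.monotone hlt)) le_rfl hj.1 hj.2.le
      _ ≤ D * ρ (b (i + 1)) := by gcongr; exact hchain j hlt
      _ ≤ D * (D * ρ t₀) := by gcongr; exact hcell i t₀ _ le_rfl hi.1 hi.2.le le_rfl
      _ = D ^ 2 * ρ t₀ := by ring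

/-- Decay for a differential inequality `ρ' ≤ μ ρ` along cells `b i ≤ p i ≤ q i ≤ c i ≤ b (i + 1)`:
the rate `N i` on the ramps `(b i, p i)` and `(q i, c i)` may be huge but is offset by their
shortness, the rate on the gap `(c i, b (i + 1))` is at most `M` for a time at most `L`, and the
decay on the plateau `(p i, q i)` outweighs both. -/
theorem le_mul_of_alternating_rates {b p q c N : ℤ → ℝ} {M L β t₀ : ℝ} {ρ ρ' μ : ℝ → ℝ}
    (hbp : ∀ i, b i < p i) (hpq : ∀ i, p i ≤ q i) (hqc : ∀ i, q i ≤ c i)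
    (hcb : ∀ i, c i ≤ b (i + 1)) (htop : Tendsto b atTop atTop) (hbot : Tendsto b atBot atBot)
    (hNp : ∀ i, N i * (p i - b i) ≤ 1) (hNq : ∀ i, N i * (c i - q i) ≤ 1)
    (hM : 0 ≤ M) (hgap : ∀ i, b (i + 1) - c i ≤ L) (hβ : 0 ≤ β)
    (hplateau : ∀ i, 2 + M * L ≤ β * (q i - p i))
    (hμp : ∀ i, ∀ t ∈ Ioo (b i) (p i), μ t ≤ N i)
    (hμq : ∀ i, ∀ t ∈ Ioo (p i) (q i), μ t ≤ -β)
    (hμc : ∀ i, ∀ t ∈ Ioo (q i) (c i), μ t ≤ N i)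
    (hμb : ∀ i, ∀ t ∈ Ioo (c i) (b (i + 1)), μ t ≤ M)
    (hρ : ∀ t, t₀ ≤ t → 0 ≤ ρ t) (hcont : ContinuousOn ρ (Ici t₀))
    (hder : ∀ t, t₀ < t → HasDerivAt ρ (ρ' t) t) (hle : ∀ t, t₀ < t → ρ' t ≤ μ t * ρ t)
    {t : ℝ} (ht : t₀ ≤ t) :
    ρ t ≤ Real.exp (2 + M * L) ^ 2 * ρ t₀ := by
  have hL : 0 ≤ L := (sub_nonneg.2 (hcb 0)).trans (hgap 0)
  have hb : StrictMono b := strictMono_int_of_lt_succ fun i =>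
    (hbp i).trans_le ((hpq i).trans ((hqc i).trans (hcb i)))
  have hstep : ∀ {x y κ : ℝ}, (∀ t ∈ Ioo x y, μ t ≤ κ) → ∀ s t, t₀ ≤ s → x ≤ s → s ≤ t → t ≤ y →
      ρ t ≤ ρ s * Real.exp (κ * (t - s)) := fun hμ s t h0 hx hst hy =>
    le_mul_exp_of_hasDerivAt_le hst (hcont.mono fun τ hτ => h0.trans hτ.1)
      (fun τ hτ => hder τ (h0.trans_lt hτ.1)) (fun τ hτ => (hle τ (h0.trans_lt hτ.1)).trans
        (mul_le_mul_of_nonneg_right (hμ τ ⟨hx.trans_lt hτ.1, hτ.2.trans_le hy⟩)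
          (hρ τ (h0.trans hτ.1.le))))
  have hgrow : ∀ {x y κ C : ℝ}, 0 ≤ C → κ * (y - x) ≤ C → (∀ t ∈ Ioo x y, μ t ≤ κ) →
      ∀ s t, t₀ ≤ s → x ≤ s → s ≤ t → t ≤ y → ρ t ≤ Real.exp C * ρ s := by
    intro x y κ C hC hκ hμ s t h0 hx hst hy
    refine (hstep hμ s t h0 hx hst hy).trans ?_
    rw [mul_comm]
    refine mul_le_mul_of_nonneg_right (Real.exp_le_exp.2 ?_) (hρ s h0)
    rcases le_total 0 κ with h | h
    · exact (mul_le_mul_of_nonneg_left (by linarith) h).trans hκ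
    · exact (mul_nonpos_of_nonpos_of_nonneg h (sub_nonneg.2 hst)).trans hC
  have hML : 0 ≤ M * L := mul_nonneg hM hL
  have hgapexp : ∀ i, M * (b (i + 1) - c i) ≤ M * L := fun i =>
    mul_le_mul_of_nonneg_left (hgap i) hM
  refine le_sq_mul_of_cells hb htop hbot hρ (Real.one_le_exp (by positivity)) ?_ ?_ ht
  · intro i
    have hone : ∀ {C : ℝ}, 0 ≤ C → 1 ≤ Real.exp C := fun h => Real.one_le_exp h
    have h12 := growth_concat hρ (hone zero_le_one) (hone le_rfl)
      (hgrow zero_le_one (hNp i) (hμp i))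
      (hgrow le_rfl (by nlinarith [hpq i] : -β * (q i - p i) ≤ 0) (hμq i))
    have h123 := growth_concat hρ (by rw [← Real.exp_add]; exact hone (by norm_num))
      (hone zero_le_one) h12 (hgrow zero_le_one (hNq i) (hμc i))
    have h := growth_concat hρ
      (by rw [← Real.exp_add, ← Real.exp_add]; exact hone (by norm_num)) (hone hML) h123
      (hgrow hML (hgapexp i) (hμb i))
    rw [← Real.exp_add, ← Real.exp_add, ← Real.exp_add] at h
    rwa [show (1 : ℝ) + 0 + 1 + M * L = 2 + M * L by ring] at h
  · intro i h0
    have hp := h0.trans (hbp i).le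
    have hq := hp.trans (hpq i)
    have hc := hq.trans (hqc i)
    have h1 := hstep (hμp i) (b i) (p i) h0 le_rfl (hbp i).le le_rfl
    have h2 := hstep (hμq i) (p i) (q i) hp le_rfl (hpq i) le_rfl
    have h3 := hstep (hμc i) (q i) (c i) hq le_rfl (hqc i) le_rfl
    have h4 := hstep (hμb i) (c i) (b (i + 1)) hc le_rfl (hcb i) le_rfl
    have hb0 := hρ (b i) h0
    calc ρ (b (i + 1))
        ≤ ρ (b i) * Real.exp (N i * (p i - b i)) * Real.exp (-β * (q i - p i)) *
            Real.exp (N i * (c i - q i)) * Real.exp (M * (b (i + 1) - c i)) := by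
          refine h4.trans ?_
          gcongr
          refine h3.trans ?_
          gcongr
          refine h2.trans ?_
          gcongr
      _ = ρ (b i) * Real.exp (N i * (p i - b i) + -β * (q i - p i) +
            N i * (c i - q i) + M * (b (i + 1) - c i)) := by
          rw [Real.exp_add, Real.exp_add, Real.exp_add]; ring
      _ ≤ ρ (b i) * 1 := by
          refine mul_le_mul_of_nonneg_left (Real.exp_le_one_iff.2 ?_) hb0
          linarith [hNp i, hNq i, hgapexp i, hplateau i]
      _ = ρ (b i) := mul_one _

/-! ### The Jacobian matrices as logarithmic norms -/

theorem dotProduct_symJacobian_mulVec {n : ℕ} (F : TimeVectorField n) (t : ℝ)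
    (x v : EuclideanSpace ℝ (Fin n)) :
    v.ofLp ⬝ᵥ (symJacobian F t x *ᵥ v.ofLp) = 2 * inner ℝ v (fderiv ℝ (F t) x v) := by
  have hJ : jacobian F t x *ᵥ v.ofLp = (fderiv ℝ (F t) x v).ofLp := by
    ext i
    have hv : v = ∑ j, v j • EuclideanSpace.single j (1 : ℝ) := by
      ext k
      simp [Finset.sum_apply, Pi.single_apply]
    conv_rhs => rw [hv]
    simp [jacobian, Matrix.mulVec, dotProduct, mul_comm]
  have hin : v.ofLp ⬝ᵥ (jacobian F t x *ᵥ v.ofLp) = inner ℝ v (fderiv ℝ (F t) x v) := by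
    rw [hJ, EuclideanSpace.inner_eq_star_dotProduct, dotProduct_comm]
    simp
  rw [symJacobian, add_mulVec, dotProduct_add, hin, mulVec_transpose, dotProduct_comm,
    ← dotProduct_mulVec, hin, two_mul]

theorem dotProduct_smul_one_mulVec {n : ℕ} (c : ℝ) (v : EuclideanSpace ℝ (Fin n)) :
    v.ofLp ⬝ᵥ ((c • (1 : Matrix (Fin n) (Fin n) ℝ)) *ᵥ v.ofLp) = c * ‖v‖ ^ 2 := by
  rw [smul_mulVec, one_mulVec, dotProduct_smul, EuclideanSpace.real_norm_sq_eq, smul_eq_mul]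
  simp [dotProduct, sq]

theorem logNormLE_of_quadLE {n : ℕ} {F : TimeVectorField n} {t c : ℝ}
    (h : ∀ x, QuadLE (symJacobian F t x) (c • 1)) : LogNormLE (F t) c := fun x v => by
  have := h x v.ofLp
  rwa [dotProduct_symJacobian_mulVec, dotProduct_smul_one_mulVec] at this

theorem logNormLE_neg_of_quadLE {n : ℕ} {F : TimeVectorField n} {t c : ℝ}
    (h : ∀ x, QuadLE (c • 1) (symJacobian F t x)) : LogNormLE (fun x => -F t x) (-c) :=
  fun x v => by
    have := h x v.ofLp
    rw [dotProduct_symJacobian_mulVec, dotProduct_smul_one_mulVec] at this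
    rw [fderiv_fun_neg, _root_.neg_apply, inner_neg_right]
    linarith

theorem LogNormLE.add_smul {E : Type*} [NormedAddCommGroup E] [InnerProductSpace ℝ E]
    {f g : E → E} {c d w : ℝ} (hf : LogNormLE f c) (hg : LogNormLE g d)
    (hdf : Differentiable ℝ f) (hdg : Differentiable ℝ g) (hw : 0 ≤ w) :
    LogNormLE (fun x => f x + w • g x) (c + w * d) := fun x v => by
  have h : fderiv ℝ (fun x => f x + w • g x) x = fderiv ℝ f x + w • fderiv ℝ g x :=
    ((hdf x).hasFDerivAt.add ((hdg x).hasFDerivAt.const_smul w)).fderiv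
  rw [h, _root_.add_apply, _root_.smul_apply, inner_add_right, inner_smul_right]
  nlinarith [hf x v, mul_le_mul_of_nonneg_left (hg x v) hw]

/-! ### The feedback -/

/-- A `C²` plateau function: it vanishes outside `(b, c)` and equals `1` on `[b + δ, c - δ]`. -/
noncomputable def plateau (b c δ t : ℝ) : ℝ :=
  Real.smoothTransition ((t - b) / δ) * Real.smoothTransition ((c - t) / δ)

theorem contDiff_plateau (b c δ : ℝ) : ContDiff ℝ 2 (plateau b c δ) :=
  (Real.smoothTransition.contDiff.comp (by fun_prop)).mul
    (Real.smoothTransition.contDiff.comp (by fun_prop))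

theorem plateau_nonneg (b c δ t : ℝ) : 0 ≤ plateau b c δ t :=
  mul_nonneg (Real.smoothTransition.nonneg _) (Real.smoothTransition.nonneg _)

theorem plateau_eq_zero_of_le {b c δ t : ℝ} (hδ : 0 < δ) (h : t ≤ b) : plateau b c δ t = 0 := by
  rw [plateau, Real.smoothTransition.zero_of_nonpos
    (div_nonpos_of_nonpos_of_nonneg (sub_nonpos.2 h) hδ.le), zero_mul]

theorem plateau_eq_zero_of_ge {b c δ t : ℝ} (hδ : 0 < δ) (h : c ≤ t) : plateau b c δ t = 0 := by
  rw [plateau, Real.smoothTransition.zero_of_nonpos (x := (c - t) / δ)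
    (div_nonpos_of_nonpos_of_nonneg (sub_nonpos.2 h) hδ.le), mul_zero]

theorem plateau_eq_one {b c δ t : ℝ} (hδ : 0 < δ) (h : b + δ ≤ t) (h' : t ≤ c - δ) :
    plateau b c δ t = 1 := by
  rw [plateau, Real.smoothTransition.one_of_one_le ((one_le_div hδ).2 (by linarith)),
    Real.smoothTransition.one_of_one_le ((one_le_div hδ).2 (by linarith)), mul_one]

theorem IsC2Field.differentiable {n : ℕ} {F : TimeVectorField n} (hF : IsC2Field F) (t : ℝ) :
    Differentiable ℝ (F t) :=
  (ContDiff.comp hF (by fun_prop : ContDiff ℝ 2 fun x : EuclideanSpace ℝ (Fin n) =>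
    (t, x))).differentiable two_ne_zero

theorem IsC2Field.closedLoop {n : ℕ} {f G : TimeVectorField n} {u : ℝ → ℝ} (hf : IsC2Field f)
    (hG : IsC2Field G) (hu : ContDiff ℝ 2 u) : IsC2Field (closedLoop f G u) :=
  ContDiff.add hf ((hu.comp contDiff_fst).smul hG)

/-- There is a `C²` input for which the closed loop has, at each time `t`, a logarithmic norm bound
`Λ t` that is locally bounded and makes every differential inequality `r' ≤ Λ r` decay at the rate
`2 α`, with one constant for all initial times. -/
theorem exists_feedback {n : ℕ} {f G : TimeVectorField n} (hf : IsC2Field f) (hG : IsC2Field G)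
    (h : AlternatingDefiniteness f G) {α : ℝ} (hα : 0 < α) :
    ∃ (u Λ : ℝ → ℝ) (D : ℝ), ContDiff ℝ 2 u ∧ (∀ t, LogNormLE (closedLoop f G u t) (Λ t)) ∧
      (∀ s t, ∃ κ, ∀ τ ∈ Icc s t, Λ τ ≤ κ) ∧ 0 < D ∧
      ∀ (t₀ : ℝ) (r r' : ℝ → ℝ), (∀ t, 0 ≤ r t) →
        (∀ t ∈ Ici t₀, HasDerivWithinAt r (r' t) (Ici t₀) t) →
        (∀ t ∈ Ici t₀, r' t ≤ Λ t * r t) →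
        ∀ t, t₀ ≤ t → r t ≤ D * r t₀ * Real.exp (-(2 * α) * (t - t₀)) := by
  obtain ⟨m, hm, a, ha, htop, hbot, hsign, ⟨M, ε, hM, hε, hεbdd, hgapM, hactive⟩,
    k, L, hk, hL, hlen⟩ := h
  set b : ℤ → ℝ := fun i => a (2 * i) with hb_def
  set c : ℤ → ℝ := fun i => a (2 * i + 1) with hc_def
  have hbsucc : ∀ i, b (i + 1) = a (2 * i + 2) := fun i => by rw [hb_def]; ring_nf
  have hbc : ∀ i, b i < c i := fun i => ha (by lia)
  have hcb : ∀ i, c i < b (i + 1) := fun i => by rw [hbsucc]; exact ha (by lia)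
  have hb : StrictMono b := strictMono_int_of_lt_succ fun i => (hbc i).trans (hcb i)
  have hbtop : Tendsto b atTop atTop :=
    htop.comp (tendsto_atTop_mono' _ ((eventually_ge_atTop 0).mono fun i hi => by
      change id i ≤ 2 * i; simp only [id]; lia) tendsto_id)
  have hbbot : Tendsto b atBot atBot :=
    hbot.comp (tendsto_atBot_mono' _ ((eventually_le_atBot 0).mono fun i hi => by
      change 2 * i ≤ id i; simp only [id]; lia) tendsto_id)
  have hE : ∀ i, ∃ E, 0 < E ∧ ∀ t ∈ Icc (b i) (c i), LogNormLE (f t) E := fun i => by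
    obtain ⟨E, hEub⟩ := hεbdd i
    refine ⟨E, (hε (b i)).trans_le (hEub (mem_image_of_mem ε (left_mem_Icc.2 (hbc i).le))),
      fun t ht => (logNormLE_of_quadLE (hactive i t ht)).mono (hEub (mem_image_of_mem ε ht))⟩
  choose E hE0 hE using hE
  have hσ : ∀ i, ∃ σ : ℝ, ∀ t ∈ Icc (b i) (c i), LogNormLE (fun x => σ • G t x) (-m) := fun i => by
    rcases hsign i with hpos | hneg
    · refine ⟨-1, fun t ht => ?_⟩
      simpa only [neg_one_smul] using logNormLE_neg_of_quadLE (hpos t ht)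
    · refine ⟨1, fun t ht => ?_⟩
      simpa only [one_smul] using logNormLE_of_quadLE (hneg t ht)
  choose σ hσ using hσ
  set M' : ℝ := M + 2 * α with hM'
  have hM'0 : 0 < M' := by positivity
  -- Over a plateau, of length at least `k / 2`, the decay at rate `β` must make up for a factor
  -- `exp 2` from the two ramps and `exp (M' * L)` from the gap.
  set β : ℝ := 2 * (2 + M' * L) / k with hβ
  have hβ0 : 0 < β := by positivity
  set N : ℤ → ℝ := fun i => E i + 2 * α with hN
  have hN0 : ∀ i, 0 < N i := fun i => add_pos (hE0 i) (by positivity)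
  set δ : ℤ → ℝ := fun i => min (k / 4) (1 / N i) with hδ
  have hδ0 : ∀ i, 0 < δ i := fun i => lt_min (by positivity) (one_div_pos.2 (hN0 i))
  have hNδ : ∀ i, N i * δ i ≤ 1 := fun i =>
    (mul_le_mul_of_nonneg_left (min_le_right _ _) (hN0 i).le).trans_eq
      (mul_one_div_cancel (hN0 i).ne')
  have hδk : ∀ i, δ i ≤ k / 4 := fun i => min_le_left _ _
  have hkc : ∀ i, k ≤ c i - b i := fun i => (hlen i).1
  set w : ℤ → ℝ → ℝ := fun i t => (N i + β) / m * plateau (b i) (c i) (δ i) t with hw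
  have hw0 : ∀ i t, 0 ≤ w i t := fun i t =>
    mul_nonneg (div_nonneg (add_pos (hN0 i) hβ0).le hm.le) (plateau_nonneg _ _ _ _)
  obtain ⟨u, hu, hueq⟩ := exists_contDiff_glue (k := 2) hbc hcb hbtop hbbot
    (g := fun i t => w i t * σ i)
    (fun i => (contDiff_const.mul (contDiff_plateau _ _ _)).mul contDiff_const)
    (fun i t ht => by simp [hw, plateau_eq_zero_of_le (hδ0 i) ht])
    (fun i t ht => by simp [hw, plateau_eq_zero_of_ge (hδ0 i) ht])
  have hLN_active : ∀ i, ∀ t ∈ Icc (b i) (c i),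
      LogNormLE (closedLoop f G u t) (E i - m * w i t) := fun i t ht => by
    have h := (hE i t ht).add_smul (hσ i t ht) (hf.differentiable t)
      ((hG.differentiable t).const_smul (σ i)) (hw0 i t)
    have hFt : closedLoop f G u t = fun x => f t x + w i t • σ i • G t x := by
      funext x
      rw [closedLoop, hueq i t ⟨ht.1, ht.2.trans_lt (hcb i)⟩, mul_smul]
    rw [hFt]
    exact h.mono (by linarith)
  have hLN_gap : ∀ i, ∀ t ∈ Ico (c i) (b (i + 1)), LogNormLE (closedLoop f G u t) M :=
    fun i t ht => by
      have hFt : closedLoop f G u t = f t := by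
        funext x
        rw [closedLoop, hueq i t ⟨(hbc i).le.trans ht.1, ht.2⟩]
        simp [hw, plateau_eq_zero_of_ge (hδ0 i) ht.1]
      rw [hFt]
      exact logNormLE_of_quadLE (hgapM i t ⟨ht.1, ht.2.le.trans_eq (hbsucc i)⟩)
  have hΛex : ∀ t, ∃ l, LogNormLE (closedLoop f G u t) l ∧
      ∀ i, b i ≤ t → t < b (i + 1) → l = if t ≤ c i then E i - m * w i t else M := fun t => by
    obtain ⟨i, hi⟩ := exists_mem_Ico_of_tendsto hb hbtop hbbot t
    refine ⟨if t ≤ c i then E i - m * w i t else M, ?_, fun j h1 h2 => by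
      rw [eq_of_mem_Ico hb hi ⟨h1, h2⟩]⟩
    split_ifs with htc
    · exact hLN_active i t ⟨hi.1, htc⟩
    · exact hLN_gap i t ⟨(not_le.1 htc).le, hi.2⟩
  choose Λ hΛ hΛeq using hΛex
  have hΛE : ∀ i, ∀ t ∈ Ico (b i) (b (i + 1)), t ≤ c i → Λ t ≤ E i := fun i t ht htc => by
    rw [hΛeq t i ht.1 ht.2, if_pos htc]
    linarith [mul_nonneg hm.le (hw0 i t)]
  have hΛM : ∀ i, ∀ t ∈ Ico (b i) (b (i + 1)), c i < t → Λ t ≤ M := fun i t ht htc => by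
    rw [hΛeq t i ht.1 ht.2, if_neg (not_le.2 htc)]
  have hΛβ : ∀ i, ∀ t ∈ Ioo (b i + δ i) (c i - δ i), Λ t = -(2 * α) - β := fun i t ht => by
    have htc : t ≤ c i := by linarith [ht.2, hδ0 i]
    rw [hΛeq t i (by linarith [ht.1, hδ0 i]) (htc.trans_lt (hcb i)), if_pos htc, hw]
    simp only [plateau_eq_one (hδ0 i) ht.1.le ht.2.le, mul_one, mul_div_cancel₀ _ hm.ne', hN]
    ring
  refine ⟨u, Λ, Real.exp (2 + M' * L) ^ 2, hu, hΛ, fun s t => ?_, by positivity, ?_⟩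
  · obtain ⟨i, hi⟩ := exists_mem_Ico_of_tendsto hb hbtop hbbot s
    obtain ⟨j, hj⟩ := exists_mem_Ico_of_tendsto hb hbtop hbbot t
    obtain ⟨κ, hκ⟩ := ((finite_Icc i j).image E).bddAbove
    refine ⟨max κ M, fun τ hτ => ?_⟩
    obtain ⟨l, hl⟩ := exists_mem_Ico_of_tendsto hb hbtop hbbot τ
    rcases le_or_gt τ (c l) with h | h
    · have h1 := hb.lt_iff_lt.1 (hi.1.trans_lt (hτ.1.trans_lt hl.2))
      have h2 := hb.lt_iff_lt.1 (hl.1.trans_lt (hτ.2.trans_lt hj.2))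
      exact (hΛE l τ hl h).trans ((hκ (mem_image_of_mem E
        ⟨Int.lt_add_one_iff.1 h1, Int.lt_add_one_iff.1 h2⟩)).trans (le_max_left _ _))
    · exact (hΛM l τ hl h).trans (le_max_right _ _)
  · intro t₀ r r' hr hder hle t ht
    have hexp : ∀ τ, HasDerivAt (fun τ => Real.exp (2 * α * (τ - t₀)))
        (Real.exp (2 * α * (τ - t₀)) * (2 * α * 1)) τ := fun τ =>
      (((hasDerivAt_id τ).sub_const t₀).const_mul (2 * α)).exp
    have key := le_mul_of_alternating_rates (b := b) (c := c) (p := fun i => b i + δ i)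
      (q := fun i => c i - δ i) (N := N) (M := M') (L := L) (β := β) (t₀ := t₀)
      (ρ := fun τ => r τ * Real.exp (2 * α * (τ - t₀)))
      (ρ' := fun τ => (r' τ + 2 * α * r τ) * Real.exp (2 * α * (τ - t₀)))
      (μ := fun τ => Λ τ + 2 * α)
      (fun i => by linarith [hδ0 i]) (fun i => by linarith [hδk i, hkc i])
      (fun i => by linarith [hδ0 i]) (fun i => (hcb i).le) hbtop hbbot
      (fun i => by simpa using hNδ i) (fun i => by simpa using hNδ i) hM'0.le
      (fun i => by rw [hbsucc]; exact (hlen i).2) hβ0.le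
      (fun i => by
        have h1 : k / 2 ≤ c i - δ i - (b i + δ i) := by linarith [hδk i, hkc i]
        calc 2 + M' * L = β * (k / 2) := by rw [hβ]; field_simp
          _ ≤ _ := mul_le_mul_of_nonneg_left h1 hβ0.le)
      (fun i τ hτ => by
        have htc : τ ≤ c i := by linarith [hτ.2, hδk i, hkc i]
        linarith [hΛE i τ ⟨hτ.1.le, htc.trans_lt (hcb i)⟩ htc])
      (fun i τ hτ => by linarith [hΛβ i τ hτ])
      (fun i τ hτ => by
        have hbt : b i ≤ τ := by linarith [hτ.1, hδk i, hkc i]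
        linarith [hΛE i τ ⟨hbt, hτ.2.trans (hcb i)⟩ hτ.2.le])
      (fun i τ hτ => by linarith [hΛM i τ ⟨((hbc i).trans hτ.1).le, hτ.2⟩ hτ.1])
      (fun τ _ => mul_nonneg (hr τ) (Real.exp_pos _).le)
      (fun τ hτ => ((hder τ hτ).continuousWithinAt).mul (hexp τ).continuousAt.continuousWithinAt)
      (fun τ hτ => (((hder τ hτ.le).hasDerivAt (Ici_mem_nhds hτ)).mul (hexp τ)).congr_deriv
        (by ring))
      (fun τ hτ => by
        have := mul_le_mul_of_nonneg_right (hle τ hτ.le) (Real.exp_pos (2 * α * (τ - t₀))).le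
        linarith)
      ht
    simp only [sub_self, mul_zero, Real.exp_zero, mul_one] at key
    calc r t = r t * Real.exp (2 * α * (t - t₀)) * Real.exp (-(2 * α) * (t - t₀)) := by
          rw [mul_assoc, ← Real.exp_add]; simp
      _ ≤ _ := by gcongr

/-! ### Stabilization -/

theorem le_sqrt_mul_of_sq_le {x y D κ : ℝ} (hx : 0 ≤ x) (hy : 0 ≤ y) (hD : 0 ≤ D)
    (h : x ^ 2 ≤ D * y ^ 2 * Real.exp (2 * κ)) : x ≤ √D * y * Real.exp κ := by
  refine (sq_le_sq₀ hx (by positivity)).1 (h.trans_eq ?_)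
  rw [mul_pow, mul_pow, Real.sq_sqrt hD, ← Real.exp_nat_mul, Nat.cast_ofNat]

theorem theorem2 (n : ℕ) (f G : TimeVectorField n)
    (hf : IsC2Field f) (hG : IsC2Field G)
    (h : AlternatingDefiniteness f G) :
    ∀ α : ℝ, 0 < α → ∃ u : ℝ → ℝ, ContDiff ℝ 2 u ∧
      ForwardComplete (closedLoop f G u) ∧
      ContractiveWithRate (closedLoop f G u) α ∧
      IESWithRate (closedLoop f G u) α := by
  intro α hα
  obtain ⟨u, Λ, D, hu, hΛ, hΛbdd, hD, hdecay⟩ := exists_feedback hf hG h hα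
  have hF := hf.closedLoop hG hu
  refine ⟨u, hu, fun t₀ x₀ => exists_solution_Ici (hF.of_le one_le_two) (fun s t => ?_) t₀ x₀,
    ⟨√D, Real.sqrt_pos.2 hD, fun t₀ x δ hx hδ t ht => ?_⟩,
    ⟨√D, Real.sqrt_pos.2 hD, fun t₀ x₁ x₂ hx₁ hx₂ t ht => ?_⟩⟩
  · obtain ⟨κ, hκ⟩ := hΛbdd s t
    exact ⟨κ, fun τ hτ => (hΛ τ).mono (hκ τ hτ)⟩
  · have := hdecay t₀ (fun τ => ‖δ τ‖ ^ 2) _ (fun τ => sq_nonneg _)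
      (fun τ hτ => (hδ τ hτ).norm_sq) (fun τ _ => hΛ τ _ _) t ht
    exact le_sqrt_mul_of_sq_le (norm_nonneg _) (norm_nonneg _) hD.le
      (this.trans_eq (by ring_nf))
  · have := hdecay t₀ (fun τ => ‖x₁ τ - x₂ τ‖ ^ 2) _ (fun τ => sq_nonneg _)
      (fun τ hτ => ((hx₁ τ hτ).sub (hx₂ τ hτ)).norm_sq)
      (fun τ _ => (hΛ τ).two_inner_sub_le (hF.differentiable τ) _ _) t ht
    exact le_sqrt_mul_of_sq_le (norm_nonneg _) (norm_nonneg _) hD.le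
      (this.trans_eq (by ring_nf))
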